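/- Let $t_0<T$, $d\ge 1$, and consider the control system $$\dot x(t)=N_t(x(t))+B(t,x(t))\,u(t),\qquad x(t_0)=x^0\in\mathbb R^d,\quad t\in[t_0,T],\qquad u\in L^\infty((t_0,T);\mathbb R^k).$$ Assume that $t\mapsto N_t(x)$ is in $L^\infty((t_0,T);\mathbb R^d)$ for every $x$, that for every $t\in[t_0,T]$ the map $x\mapsto N_t(x)$ is $C^2$ with $\|DN_t\|\le\Lambda_1$ and $\|D^2N_t\|\le\Lambda_2$ on $\mathbb R^d$ ($\Lambda_1,\Lambda_2>0$), that $B\in L^\infty((t_0,T)\times\mathbb R^d;\mathbb R^{d\times k})$ (with norm $\|B\|_\infty$, matrices carrying the spectral norm), and that for every $t\in[t_0,T]$ the map $x\mapsto B(t,x)$ is $C^1$ with $\|D_xB(t,\cdot)\|\le L_B$ for some $L_B\ge0$. Let $x_u$ be the trajectory of $u$, let $\Phi_{s,t}(p)$ be the value at time $t$ of the solution of $\dot x=N_t(x)$ with $x(s)=p$, put $\tau_1=t_0$, $\tau_2=T$, $\Delta t_0=T-t_0$, fix $i\in\{1,2\}$, and let $$\mathcal N_i(u)=\int_{t_0}^T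 D\Phi_{t,\tau_i}(x_u(t))B(t,x_u(t))B(t,x_u(t))^\top D\Phi_{t,\tau_i}(x_u(t))^\top dt .$$ For $y\in\mathbb R^d$ let the synthesis map $\mathcal S_i$ send $u$ to $v(t)=B(t,x_u(t))^\top D\Phi_{t,\tau_i}(x_u(t))^\top\mathcal N_i(u)^\dagger y$, where $\dagger$ denotes the Moore–Penrose pseudoinverse. For $C_i>0$ let $$\mathcal F(C_i)=\{u\in L^\infty:\lambda_{\min}(\mathcal N_i(u))\ge C_i^{-1}\},\quad \zeta_i(y)=C_i\|B\|_\infty e^{\Lambda_1\Delta t_0}|y|,\quad \mathcal F(y)=\{u\in\mathcal F(C_i):\|u\|_\infty\le\zeta_i(y)\}.$$ Let $u^\flat\in L^\infty((t_0,T);\mathbb R^k)$ be such that $\mathcal N_i(u^\flat)$ is invertible, let $\theta\in(0,1)$ and $C_i=(1+\theta)/\lambda_{\min}(\mathcal N_i(u^\flat))$. Then the map $\mathcal N_i$ is Lipschitz on every bounded subset of $L^\infty((t_0,T);\mathbb R^k)$, and for every $y$ the map $\mathcal S_i$ is well defined from $L^\infty((t_0,T);\mathbb R^k)$ to itself. Moreover,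 let $y\in\mathbb R^d$ and let $L>0$ be a Lipschitz constant of $\mathcal N_i$ on $\{u:\|u\|_\infty\le\zeta_i(y)\}\cup\{u^\flat\}$ (that is, on the ball alone when $u^\flat$ lies in it), and assume $$\|u^\flat\|_\infty<\frac{\theta\,\lambda_{\min}(\mathcal N_i(u^\flat))}{(1+\theta)L}.$$ Then $\mathcal F(C_i)\ne\emptyset$, and the self-map property $\mathcal S_i(\mathcal F(y))\subset\mathcal F(y)$ holds whenever $$|y|\le\vartheta(u^\flat):=\frac{\lambda_{\min}(\mathcal N_i(u^\flat))}{(1+\theta)\|B\|_\infty e^{\Lambda_1\Delta t_0}}\left(\frac{\theta\,\lambda_{\min}(\mathcal N_i(u^\flat))}{(1+\theta)L}-\|u^\flat\|_\infty\right).$$ -/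

import Mathlib

open MeasureTheory Set
open scoped ENNReal NNReal

noncomputable section

/-- `ℝⁿ` with the Euclidean norm. -/
abbrev Vec (n : ℕ) : Type := EuclideanSpace ℝ (Fin n)

/-- `x` is the (absolutely continuous) solution on `[a, b]` of `x' = f(t, x)`, `x(s) = p`, where
`s ∈ [a, b]` and `f` need only be measurable in time: the equation holds in integral form, which is
the same as absolute continuity together with the equation for almost every `t`. -/
structure IsODESolution {d : ℕ} (f : ℝ → Vec d → Vec d) (a b s : ℝ) (p : Vec d)
    (x : ℝ → Vec d) : Prop where
  continuousOn : ContinuousOn x (Icc a b)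
  intervalIntegrable : IntervalIntegrable (fun r => f r (x r)) volume a b
  eq_integral : ∀ t ∈ Icc a b, x t = p + ∫ r in s..t, f r (x r)

open Classical in
/-- The solution on `[a, b]` of `x' = f(t, x)`, `x(s) = p`, when there is one. For the
vector fields considered below there is exactly one (as a function on `[a, b]`). -/
def odeSolution {d : ℕ} (f : ℝ → Vec d → Vec d) (a b s : ℝ) (p : Vec d) : ℝ → Vec d :=
  if h : ∃ x, IsODESolution f a b s p x then h.choose else 0

/-- The smallest eigenvalue of a (symmetric) endomorphism of `ℝᵈ`, `d ≥ 1`. -/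
def lambdaMin {d : ℕ} (A : Vec d →L[ℝ] Vec d) : ℝ :=
  sInf {μ : ℝ | Module.End.HasEigenvalue (A : Vec d →ₗ[ℝ] Vec d) μ}

/-- The four Penrose equations: `X` is the Moore--Penrose pseudoinverse of `A`. -/
structure IsPseudoinverse {d : ℕ} (A X : Vec d →L[ℝ] Vec d) : Prop where
  mul_mul_left : A ∘L X ∘L A = A
  mul_mul_right : X ∘L A ∘L X = X
  selfAdjoint_left : ContinuousLinearMap.adjoint (A ∘L X) = A ∘L X
  selfAdjoint_right : ContinuousLinearMap.adjoint (X ∘L A) = X ∘L A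

open Classical in
/-- The Moore--Penrose pseudoinverse. -/
def pseudoinverse {d : ℕ} (A : Vec d →L[ℝ] Vec d) : Vec d →L[ℝ] Vec d :=
  if h : ∃ X, IsPseudoinverse A X then h.choose else 0

/-- The data of the control-affine system `x'(t) = N_t(x(t)) + B(t, x(t)) u(t)` on `[t₀, T]`. -/
structure ControlSystem (d k : ℕ) where
  /-- initial time -/
  t₀ : ℝ
  /-- final time -/
  T : ℝ
  /-- the drift `N_t(x)` -/
  N : ℝ → Vec d → Vec d
  /-- the input matrix `B(t, x)`, as a linear map with the operator (spectral) norm -/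
  B : ℝ → Vec d → (Vec k →L[ℝ] Vec d)

namespace ControlSystem

variable {d k : ℕ}

/-- Lebesgue measure on `(t₀, T)`. -/
def timeMeasure (S : ControlSystem d k) : Measure ℝ := volume.restrict (Ioo S.t₀ S.T)

/-- Lebesgue measure on `(t₀, T) × ℝᵈ`. -/
def timeSpaceMeasure (S : ControlSystem d k) : Measure (ℝ × Vec d) :=
  S.timeMeasure.prod volume

/-- The standing assumptions on the drift `N` and on the input matrix `B`. -/
structure Regular (S : ControlSystem d k) (Λ₁ Λ₂ L_B : ℝ) : Prop where
  time_lt : S.t₀ < S.T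
  drift_memLp : ∀ x : Vec d, MemLp (fun t => S.N t x) ∞ S.timeMeasure
  drift_contDiff : ∀ t ∈ Icc S.t₀ S.T, ContDiff ℝ 2 (S.N t)
  Λ₁_pos : 0 < Λ₁
  Λ₂_pos : 0 < Λ₂
  drift_fderiv_le : ∀ t ∈ Icc S.t₀ S.T, ∀ x : Vec d, ‖fderiv ℝ (S.N t) x‖ ≤ Λ₁
  drift_fderiv_fderiv_le : ∀ t ∈ Icc S.t₀ S.T, ∀ x : Vec d,
    ‖fderiv ℝ (fderiv ℝ (S.N t)) x‖ ≤ Λ₂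
  input_memLp : MemLp (Function.uncurry S.B) ∞ S.timeSpaceMeasure
  input_contDiff : ∀ t ∈ Icc S.t₀ S.T, ContDiff ℝ 1 (S.B t)
  L_B_nonneg : 0 ≤ L_B
  input_fderiv_le : ∀ t ∈ Icc S.t₀ S.T, ∀ x : Vec d, ‖fderiv ℝ (S.B t) x‖ ≤ L_B

/-- `‖B‖_∞`, the norm of `B` in `L^∞((t₀, T) × ℝᵈ; ℝ^{d × k})`. -/
def inputNorm (S : ControlSystem d k) : ℝ :=
  (eLpNorm (Function.uncurry S.B) ∞ S.timeSpaceMeasure).toReal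

/-- The control space `L^∞((t₀, T); ℝᵏ)` with its essential supremum norm. -/
abbrev Control (S : ControlSystem d k) : Type := Lp (Vec k) ∞ S.timeMeasure

/-- The flow of the drift: `flow s t p` is `Φ_{s,t}(p)`, the value at time `t` of the solution of
`x' = N_t(x)` with `x(s) = p`. -/
def flow (S : ControlSystem d k) (s t : ℝ) (p : Vec d) : Vec d :=
  odeSolution S.N S.t₀ S.T s p t

/-- The trajectory `x_u` of the control system issued from `x₀` at time `t₀`. -/
def trajectory (S : ControlSystem d k) (x₀ : Vec d) (u : S.Control) : ℝ → Vec d :=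
  odeSolution (fun t x => S.N t x + S.B t x (u t)) S.t₀ S.T S.t₀ x₀

/-- The times `τ₁ = t₀` and `τ₂ = T`; the indices `1, 2` are written `0, 1 : Fin 2`. -/
def tau (S : ControlSystem d k) (i : Fin 2) : ℝ := if i = 0 then S.t₀ else S.T

/-- `DΦ_{t,τ_i}(x_u(t)) B(t, x_u(t))`. -/
def kernel (S : ControlSystem d k) (i : Fin 2) (x₀ : Vec d) (u : S.Control) (t : ℝ) :
    Vec k →L[ℝ] Vec d :=
  fderiv ℝ (S.flow t (S.tau i)) (S.trajectory x₀ u t) ∘L S.B t (S.trajectory x₀ u t)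

/-- The Gramian map
`𝒩_i(u) = ∫ DΦ_{t,τ_i}(x_u(t)) B(t, x_u(t)) B(t, x_u(t))ᵀ DΦ_{t,τ_i}(x_u(t))ᵀ dt`. -/
def gramian (S : ControlSystem d k) (i : Fin 2) (x₀ : Vec d) (u : S.Control) :
    Vec d →L[ℝ] Vec d :=
  ∫ t in S.t₀..S.T,
    S.kernel i x₀ u t ∘L ContinuousLinearMap.adjoint (S.kernel i x₀ u t)

/-- `v_i(u)(t) = B(t, x_u(t))ᵀ DΦ_{t,τ_i}(x_u(t))ᵀ 𝒩_i(u)† y`. -/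
def minimalControl (S : ControlSystem d k) (i : Fin 2) (x₀ y : Vec d) (u : S.Control) (t : ℝ) :
    Vec k :=
  ContinuousLinearMap.adjoint (S.kernel i x₀ u t) (pseudoinverse (S.gramian i x₀ u) y)

open Classical in
/-- The synthesis map `𝒮_i : L^∞ → L^∞`, `u ↦ v_i(u)`. -/
def synthesis (S : ControlSystem d k) (i : Fin 2) (x₀ y : Vec d) (u : S.Control) : S.Control :=
  if h : MemLp (S.minimalControl i x₀ y u) ∞ S.timeMeasure then h.toLp else 0

/-- The feasible coercivity class `ℱ(C) = {u : λ_min(𝒩_i(u)) ≥ C⁻¹}`. -/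
def coercivityClass (S : ControlSystem d k) (i : Fin 2) (x₀ : Vec d) (C : ℝ) : Set S.Control :=
  {u | C⁻¹ ≤ lambdaMin (S.gramian i x₀ u)}

/-- `ζ(y) = C ‖B‖_∞ e^{Λ₁ (T - t₀)} |y|`. -/
def zeta (S : ControlSystem d k) (Λ₁ C : ℝ) (y : Vec d) : ℝ :=
  C * S.inputNorm * Real.exp (Λ₁ * (S.T - S.t₀)) * ‖y‖

/-- The feasibility coercivity ball `ℱ(y) = {u ∈ ℱ(C) : ‖u‖_∞ ≤ ζ(y)}`. -/
def feasibleBall (S : ControlSystem d k) (i : Fin 2) (x₀ : Vec d) (Λ₁ C : ℝ) (y : Vec d) :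
    Set S.Control :=
  {u | u ∈ S.coercivityClass i x₀ C ∧ ‖u‖ ≤ S.zeta Λ₁ C y}

/-- The admissible radius `ϑ(u)`, for a Lipschitz constant `L` of the Gramian map. -/
def admissibleRadius (S : ControlSystem d k) (i : Fin 2) (x₀ : Vec d) (Λ₁ θ L : ℝ)
    (u : S.Control) : ℝ :=
  lambdaMin (S.gramian i x₀ u) /
      ((1 + θ) * S.inputNorm * Real.exp (Λ₁ * (S.T - S.t₀))) *
    (θ * lambdaMin (S.gramian i x₀ u) / ((1 + θ) * L) - ‖u‖)

end ControlSystem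

end

open Filter Topology

/-! ### Grönwall's inequality in integral form and Carathéodory differential equations -/

section Caratheodory

variable {E F : Type*} [NormedAddCommGroup E] [NormedAddCommGroup F]

/-! The self-map property is a perturbation argument around `uref`. Write `l` for the smallest
eigenvalue of its Gramian. If `u` lies in the coercivity class, the pseudoinverse costs at most a
factor `C`, and the kernel is bounded a.e. by `‖B‖_∞ e^{Λ₁Δt₀}`; hence `v = 𝒮(u)` has norm at most
`ζ(y)` (`norm_synthesis_le`). So `v` lies where `L` is a Lipschitz constant. Since the smallest
eigenvalue is 1-Lipschitz in operator norm (`lambdaMin_sub_norm_sub_le`), the Gramian of `v` has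
smallest eigenvalue at least `l - L (ζ(y) + ‖uref‖)`. The radius is chosen so that the loss is at
most `θ l / (1 + θ)`, which leaves `l / (1 + θ) = C⁻¹`. The class is nonempty because it contains
`uref`.

The analytic work is the local Lipschitz bound for the Gramian (`exists_lipschitzOnWith_gramian`).
The fields are only measurable in time, so solutions are handled in integral form: Picard iteration
gives existence, and one perturbed Grönwall estimate, `IsPrimitiveOn.norm_sub_le`, gives every
stability bound. It shows that the flow is Lipschitz, that its derivative solves the variational
equation and is Lipschitz in the base point (through `Λ₂`), and that trajectories are Lipschitz in
the control. -/

theorem le_mul_exp_of_le_add_integral {g : ℝ → ℝ} (hg : Continuous g) {A K s b : ℝ} (hK : 0 ≤ K)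
    (h : ∀ t ∈ Icc s b, g t ≤ A + K * ∫ r in s..t, g r) :
    ∀ t ∈ Icc s b, g t ≤ A * Real.exp (K * (t - s)) := by
  intro t ht
  set G : ℝ → ℝ := fun t => A + K * ∫ r in s..t, g r with hG
  have hGd : ∀ t, HasDerivAt G (K * g t) t := fun t =>
    ((hg.integral_hasStrictDerivAt s t).hasDerivAt.const_mul K).const_add A
  have hHd : ∀ t, HasDerivAt (fun t => G t * Real.exp (-(K * (t - s))))
      (K * g t * Real.exp (-(K * (t - s))) + G t * (Real.exp (-(K * (t - s))) * (-(K * 1)))) t := by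
    intro t
    exact (hGd t).mul ((((hasDerivAt_id t).sub_const s).const_mul K).neg.exp)
  -- Integrating factor: the hypothesis `g ≤ G` says `G' = K g ≤ K G`, so `G e^{-K(t-s)}` decreases.
  have hanti : AntitoneOn (fun t => G t * Real.exp (-(K * (t - s)))) (Icc s b) := by
    refine antitoneOn_of_deriv_nonpos (convex_Icc s b)
      (fun t _ => (hHd t).continuousAt.continuousWithinAt)
      (fun t _ => (hHd t).differentiableAt.differentiableWithinAt) ?_
    intro t ht
    rw [(hHd t).deriv]
    have h1 := h t (interior_subset ht)
    have h2 : K * Real.exp (-(K * (t - s))) * (g t - G t) ≤ 0 :=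
      mul_nonpos_of_nonneg_of_nonpos (by positivity) (by linarith)
    linarith
  have h1 := hanti ⟨le_rfl, ht.1.trans ht.2⟩ ht ht.1
  have h2 : G s = A := by simp [hG]
  simp only [h2, sub_self, mul_zero, neg_zero, Real.exp_zero, mul_one] at h1
  calc g t ≤ G t := h t ht
    _ = G t * Real.exp (-(K * (t - s))) * Real.exp (K * (t - s)) := by
        rw [mul_assoc, ← Real.exp_add]; simp
    _ ≤ A * Real.exp (K * (t - s)) := by gcongr

/-- Two-sided Grönwall inequality in integral form. -/
theorem le_mul_exp_of_le_add_abs_integral {g : ℝ → ℝ} {A K a b s : ℝ} (hs : s ∈ Icc a b)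
    (hg : ContinuousOn g (Icc a b)) (hg0 : ∀ t ∈ Icc a b, 0 ≤ g t) (hA : 0 ≤ A) (hK : 0 ≤ K)
    (h : ∀ t ∈ Icc a b, g t ≤ A + K * |∫ r in s..t, g r|) :
    ∀ t ∈ Icc a b, g t ≤ A * Real.exp (K * (b - a)) := by
  have hab : a ≤ b := hs.1.trans hs.2
  -- Constant extension beyond the endpoints gives the global continuity that the one-sided
  -- inequality needs.
  set g' : ℝ → ℝ := IccExtend hab (fun t : Icc a b => g t)
  have hc : Continuous g' := (continuousOn_iff_continuous_domRestrict.1 hg).Icc_extend'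
  have heq : ∀ t ∈ Icc a b, g' t = g t := fun t ht => IccExtend_of_mem hab _ ht
  have h0 : ∀ t, 0 ≤ g' t := fun t => hg0 _ (projIcc a b hab t).2
  have hint : ∀ t ∈ Icc a b, ∫ r in s..t, g r = ∫ r in s..t, g' r := by
    intro t ht
    refine intervalIntegral.integral_congr fun r hr => (heq r ?_).symm
    exact (uIcc_subset_Icc hs ht) hr
  intro t ht
  rcases le_total s t with hst | hst
  · have := le_mul_exp_of_le_add_integral (s := s) (b := b) (A := A) hc hK (fun r hr => by
      have hr' : r ∈ Icc a b := ⟨hs.1.trans hr.1, hr.2⟩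
      rw [heq r hr']
      refine (h r hr').trans_eq ?_
      rw [hint r hr', abs_of_nonneg (intervalIntegral.integral_nonneg hr.1 fun u _ => h0 u)])
      t ⟨hst, ht.2⟩
    rw [heq t ht] at this
    refine this.trans ?_
    have := hs.1
    have := ht.2
    gcongr
  -- Backward in time: reflect `r ↦ -r` and apply the forward inequality.
  · have := le_mul_exp_of_le_add_integral (g := fun r => g' (-r)) (s := -s) (b := -a) (A := A)
      (hc.comp continuous_neg) hK (fun r hr => by
      have hr' : -r ∈ Icc a b := ⟨by linarith [hr.2], by linarith [hr.1, hs.2]⟩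
      rw [heq _ hr']
      refine (h _ hr').trans_eq ?_
      rw [hint _ hr', intervalIntegral.integral_comp_neg (fun r => g' r), neg_neg,
        intervalIntegral.integral_symm, abs_neg, abs_of_nonneg
          (intervalIntegral.integral_nonneg (by linarith [hr.1]) fun u _ => h0 u)])
      (-t) ⟨by linarith, by linarith [ht.1]⟩
    simp only [neg_neg] at this
    rw [heq t ht] at this
    refine this.trans ?_
    have : -t - -s ≤ b - a := by linarith [hs.2, ht.1]
    gcongr

/-- A Carathéodory function evaluated along a measurable curve is measurable. -/
theorem aestronglyMeasurable_apply_of_continuous {α : Type*} [MeasurableSpace α] {μ : Measure α}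
    {f : α → E → F} {x : α → E} (hf : ∀ c, AEStronglyMeasurable (fun t => f t c) μ)
    (hcont : ∀ᵐ t ∂μ, Continuous (f t)) (hx : AEStronglyMeasurable x μ) :
    AEStronglyMeasurable (fun t => f t (x t)) μ := by
  classical
  obtain ⟨x', hx', hxx'⟩ := hx
  have key : AEStronglyMeasurable (fun t => f t (x' t)) μ := by
    -- Approximate the curve by simple functions; on each level set only a fixed-argument section of
    -- `f` occurs, and continuity in space passes to the limit.
    refine aestronglyMeasurable_of_tendsto_ae (u := atTop)
      (f := fun n t => f t (hx'.approx n t)) (fun n => ?_) ?_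
    · have : (fun t => f t (hx'.approx n t)) = ∑ c ∈ (hx'.approx n).range,
          ((hx'.approx n) ⁻¹' {c}).indicator (fun t => f t c) := by
        ext t
        rw [Finset.sum_apply, Finset.sum_eq_single (hx'.approx n t)]
        · simp
        · intro c _ hc
          rw [indicator_of_notMem]
          simpa using hc.symm
        · intro h
          exact absurd (SimpleFunc.mem_range_self _ t) h
      rw [this]
      exact Finset.aestronglyMeasurable_sum _ fun c _ =>
        (hf c).indicator ((hx'.approx n).measurableSet_preimage _)
    · filter_upwards [hcont] with t ht
      exact (ht.tendsto _).comp (hx'.tendsto_approx t)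
  refine key.congr ?_
  filter_upwards [hxx'] with t ht
  rw [ht]

theorem IntervalIntegrable.mono_Icc {f : ℝ → E} {a b s t : ℝ}
    (h : IntervalIntegrable f volume a b) (hs : s ∈ Icc a b) (ht : t ∈ Icc a b) :
    IntervalIntegrable f volume s t :=
  h.mono_set ((uIcc_subset_Icc hs ht).trans_eq (uIcc_of_le (hs.1.trans hs.2)).symm)

/-- On `[a, b]` the field `f` is measurable in time, uniformly Lipschitz in space, and bounded
at the origin. -/
structure IsCaratheodoryLipschitz (f : ℝ → E → F) (a b K M : ℝ) : Prop where
  aestronglyMeasurable : ∀ c, AEStronglyMeasurable (fun t => f t c) (volume.restrict (Icc a b))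
  norm_sub_le : ∀ᵐ t ∂volume.restrict (Icc a b), ∀ x y, ‖f t x - f t y‖ ≤ K * ‖x - y‖
  norm_zero_le : ∀ᵐ t ∂volume.restrict (Icc a b), ‖f t 0‖ ≤ M

namespace IsCaratheodoryLipschitz

variable {f : ℝ → E → F} {a b K M : ℝ}

theorem continuous (h : IsCaratheodoryLipschitz f a b K M) :
    ∀ᵐ t ∂volume.restrict (Icc a b), Continuous (f t) := by
  filter_upwards [h.norm_sub_le] with t ht
  exact (LipschitzWith.of_dist_le' (K := K) fun x y => by
    simpa [dist_eq_norm] using ht x y).continuous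

theorem intervalIntegrable (h : IsCaratheodoryLipschitz f a b K M) (hab : a ≤ b) (hK : 0 ≤ K)
    {x : ℝ → E} (hx : ContinuousOn x (Icc a b)) :
    IntervalIntegrable (fun t => f t (x t)) volume a b := by
  obtain ⟨R, hR⟩ := isCompact_Icc.exists_bound_of_continuousOn hx
  rw [intervalIntegrable_iff_integrableOn_Icc_of_le hab]
  refine Integrable.of_bound (C := K * R + M) (aestronglyMeasurable_apply_of_continuous
    h.aestronglyMeasurable h.continuous (hx.aestronglyMeasurable measurableSet_Icc)) ?_
  filter_upwards [h.norm_sub_le, h.norm_zero_le, ae_restrict_mem measurableSet_Icc] with t h1 h2 ht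
  calc ‖f t (x t)‖ = ‖(f t (x t) - f t 0) + f t 0‖ := by rw [sub_add_cancel]
    _ ≤ ‖f t (x t) - f t 0‖ + ‖f t 0‖ := norm_add_le _ _
    _ ≤ K * ‖x t - 0‖ + M := add_le_add (h1 _ _) h2
    _ ≤ K * R + M := by rw [sub_zero]; gcongr; exact hR t ht

end IsCaratheodoryLipschitz
variable [NormedSpace ℝ E]

/-- On `[a, b]`, the curve `x` is the primitive of `f` with value `p` at `s`. -/
structure IsPrimitiveOn (x f : ℝ → E) (a b s : ℝ) (p : E) : Prop where
  continuousOn : ContinuousOn x (Icc a b)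
  intervalIntegrable : IntervalIntegrable f volume a b
  eq_integral : ∀ t ∈ Icc a b, x t = p + ∫ r in s..t, f r

namespace IsPrimitiveOn

variable {x y f g : ℝ → E} {a b s : ℝ} {p q : E}

theorem apply_base (h : IsPrimitiveOn x f a b s p) (hs : s ∈ Icc a b) : x s = p := by
  simp [h.eq_integral s hs]

/-- Rebasing makes solutions with different initial times comparable by Grönwall. -/
theorem restart (h : IsPrimitiveOn x f a b s p) (hs : s ∈ Icc a b) {s' : ℝ} (hs' : s' ∈ Icc a b) :
    IsPrimitiveOn x f a b s' (x s') where
  continuousOn := h.continuousOn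
  intervalIntegrable := h.intervalIntegrable
  eq_integral t ht := by
    rw [h.eq_integral t ht, h.eq_integral s' hs', add_assoc,
      intervalIntegral.integral_add_adjacent_intervals (h.intervalIntegrable.mono_Icc hs hs')
        (h.intervalIntegrable.mono_Icc hs' ht)]

theorem add (hx : IsPrimitiveOn x f a b s p) (hy : IsPrimitiveOn y g a b s q) (hs : s ∈ Icc a b) :
    IsPrimitiveOn (fun t => x t + y t) (fun t => f t + g t) a b s (p + q) where
  continuousOn := hx.continuousOn.add hy.continuousOn
  intervalIntegrable := hx.intervalIntegrable.add hy.intervalIntegrable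
  eq_integral t ht := by
    rw [hx.eq_integral t ht, hy.eq_integral t ht, intervalIntegral.integral_add
      (hx.intervalIntegrable.mono_Icc hs ht) (hy.intervalIntegrable.mono_Icc hs ht)]
    abel

/-- Stability of solutions: the perturbed Grönwall estimate. -/
theorem norm_sub_le (hx : IsPrimitiveOn x f a b s p) (hy : IsPrimitiveOn y g a b s q)
    (hs : s ∈ Icc a b) {K ε : ℝ} (hK : 0 ≤ K) (hε : 0 ≤ ε)
    (hfg : ∀ᵐ r ∂volume.restrict (Icc a b), ‖f r - g r‖ ≤ K * ‖x r - y r‖ + ε) :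
    ∀ t ∈ Icc a b, ‖x t - y t‖ ≤ (‖p - q‖ + ε * (b - a)) * Real.exp (K * (b - a)) := by
  have hab : a ≤ b := hs.1.trans hs.2
  have hcont : ContinuousOn (fun t => ‖x t - y t‖) (Icc a b) :=
    (hx.continuousOn.sub hy.continuousOn).norm
  have hci : IntervalIntegrable (fun t => ‖x t - y t‖) volume a b := by
    refine ContinuousOn.intervalIntegrable ?_
    rwa [uIcc_of_le hab]
  refine le_mul_exp_of_le_add_abs_integral hs hcont (fun _ _ => norm_nonneg _)
    (add_nonneg (norm_nonneg _) (mul_nonneg hε (sub_nonneg.2 hab))) hK ?_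
  intro t ht
  have h1 : x t - y t = (p - q) + ∫ r in s..t, (f r - g r) := by
    rw [hx.eq_integral t ht, hy.eq_integral t ht, intervalIntegral.integral_sub
      (hx.intervalIntegrable.mono_Icc hs ht) (hy.intervalIntegrable.mono_Icc hs ht)]
    abel
  have hae : ∀ᵐ r ∂volume.restrict (uIoc s t), ‖f r - g r‖ ≤ K * ‖x r - y r‖ + ε :=
    ae_mono (Measure.restrict_mono (uIoc_subset_uIcc.trans (uIcc_subset_Icc hs ht)) le_rfl) hfg
  have hi := hci.mono_Icc hs ht
  have h2 : ‖∫ r in s..t, (f r - g r)‖ ≤ |∫ r in s..t, (K * ‖x r - y r‖ + ε)| :=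
    intervalIntegral.norm_integral_le_abs_of_norm_le hae
      ((hi.const_mul K).add intervalIntegrable_const)
  have h3 : ∫ r in s..t, (K * ‖x r - y r‖ + ε) = K * (∫ r in s..t, ‖x r - y r‖) + ε * (t - s) := by
    rw [intervalIntegral.integral_add (hi.const_mul K) intervalIntegrable_const,
      intervalIntegral.integral_const_mul, intervalIntegral.integral_const, smul_eq_mul, mul_comm ε]
  have h4 : |t - s| ≤ b - a := abs_le.2 ⟨by linarith [hs.2, ht.1], by linarith [hs.1, ht.2]⟩
  calc ‖x t - y t‖ ≤ ‖p - q‖ + ‖∫ r in s..t, (f r - g r)‖ := by rw [h1]; exact norm_add_le _ _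
    _ ≤ ‖p - q‖ + (K * |∫ r in s..t, ‖x r - y r‖| + ε * |t - s|) := by
        gcongr
        refine h2.trans ?_
        rw [h3]
        refine (abs_add_le _ _).trans_eq ?_
        rw [abs_mul, abs_mul, abs_of_nonneg hK, abs_of_nonneg hε]
    _ ≤ ‖p - q‖ + ε * (b - a) + K * |∫ r in s..t, ‖x r - y r‖| := by
        have : ε * |t - s| ≤ ε * (b - a) := by gcongr
        linarith

end IsPrimitiveOn


namespace IsCaratheodoryLipschitz

variable {f : ℝ → E → E} {a b K M : ℝ}

/-- The Picard operator of a Carathéodory field on continuous curves. -/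
noncomputable def picard (h : IsCaratheodoryLipschitz f a b K M) (hab : a ≤ b) (hK : 0 ≤ K)
    (s : Icc a b) (p : E) (α : C(Icc a b, E)) : C(Icc a b, E) where
  toFun t := p + ∫ r in s..t, f r (IccExtend hab α r)
  continuous_toFun := by
    have hi := h.intervalIntegrable hab hK (x := IccExtend hab α)
      (α.continuous.Icc_extend').continuousOn
    have := intervalIntegral.continuousOn_primitive_interval' hi
      (a := (s : ℝ)) (by rw [uIcc_of_le hab]; exact s.2)
    rw [uIcc_of_le hab] at this
    exact continuous_const.add (continuousOn_iff_continuous_domRestrict.1 this)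

/-- Each iteration integrates one more power of `|t - s|`, which produces the factorial. Some
iterate is therefore a contraction however long the interval is. -/
theorem dist_iterate_picard_apply_le (h : IsCaratheodoryLipschitz f a b K M) (hab : a ≤ b)
    (hK : 0 ≤ K) (s : Icc a b) (p : E) (α β : C(Icc a b, E)) (n : ℕ) (t : Icc a b) :
    dist ((h.picard hab hK s p)^[n] α t) ((h.picard hab hK s p)^[n] β t) ≤
      (K * |t.1 - s.1|) ^ n / n.factorial * dist α β := by
  induction n generalizing t with
  | zero => simpa using ContinuousMap.dist_apply_le_dist (f := α) (g := β) t
  | succ n hn =>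
    set α' := (h.picard hab hK s p)^[n] α
    set β' := (h.picard hab hK s p)^[n] β
    have hi : ∀ γ : C(Icc a b, E), IntervalIntegrable (fun r => f r (IccExtend hab γ r))
        volume s t := fun γ => (h.intervalIntegrable hab hK
      (γ.continuous.Icc_extend').continuousOn).mono_Icc s.2 t.2
    rw [Function.iterate_succ_apply', Function.iterate_succ_apply', dist_eq_norm]
    change ‖(p + ∫ r in s..t, f r (IccExtend hab α' r)) -
      (p + ∫ r in s..t, f r (IccExtend hab β' r))‖ ≤ _
    rw [add_sub_add_left_eq_sub, ← intervalIntegral.integral_sub (hi α') (hi β')]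
    have hae : ∀ᵐ r ∂volume.restrict (uIoc s.1 t.1),
        ‖f r (IccExtend hab α' r) - f r (IccExtend hab β' r)‖ ≤
          K ^ (n + 1) * |r - s| ^ n / n.factorial * dist α β := by
      have hsub : uIoc s.1 t.1 ⊆ Icc a b := uIoc_subset_uIcc.trans (uIcc_subset_Icc s.2 t.2)
      filter_upwards [ae_mono (Measure.restrict_mono hsub le_rfl) h.norm_sub_le,
        ae_restrict_mem measurableSet_uIoc] with r h1 hr
      refine (h1 _ _).trans ?_
      rw [IccExtend_of_mem hab _ (hsub hr), IccExtend_of_mem hab _ (hsub hr), ← dist_eq_norm]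
      calc K * dist (α' ⟨r, hsub hr⟩) (β' ⟨r, hsub hr⟩)
          ≤ K * ((K * |r - s|) ^ n / n.factorial * dist α β) := by gcongr; exact hn _
        _ = _ := by rw [mul_pow, pow_succ]; ring
    refine (intervalIntegral.norm_integral_le_abs_of_norm_le hae
      (Continuous.intervalIntegrable (by fun_prop) _ _)).trans_eq ?_
    rw [intervalIntegral.integral_mul_const,
      intervalIntegral.integral_div, intervalIntegral.integral_const_mul, abs_mul, abs_div,
      abs_mul, intervalIntegral.abs_intervalIntegral_eq, integral_pow_abs_sub_uIoc, abs_div,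
      abs_pow, abs_pow, abs_dist, abs_of_nonneg hK, abs_abs, mul_div, div_div, ← abs_mul,
      ← Nat.cast_succ, ← Nat.cast_mul, ← Nat.factorial_succ, Nat.abs_cast, ← mul_pow]

/-- Global existence for Carathéodory differential equations with a Lipschitz field. -/
theorem exists_isPrimitiveOn [CompleteSpace E] (h : IsCaratheodoryLipschitz f a b K M)
    (hK : 0 ≤ K) {s : ℝ} (hs : s ∈ Icc a b) (p : E) :
    ∃ x, IsPrimitiveOn x (fun r => f r (x r)) a b s p := by
  have hab : a ≤ b := hs.1.trans hs.2
  obtain ⟨n, hn⟩ := (FloorSemiring.tendsto_pow_div_factorial_atTop (K * (b - a))).eventually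
    (gt_mem_nhds zero_lt_one) |>.exists
  have h0 : (0 : ℝ) ≤ (K * (b - a)) ^ n / n.factorial := by
    have : 0 ≤ b - a := sub_nonneg.2 hab
    positivity
  have hc : ContractingWith ⟨_, h0⟩ (h.picard hab hK ⟨s, hs⟩ p)^[n] := by
    refine ⟨hn, LipschitzWith.of_dist_le_mul fun α β => ?_⟩
    rw [ContinuousMap.dist_le (by positivity)]
    intro t
    refine (h.dist_iterate_picard_apply_le hab hK ⟨s, hs⟩ p α β n t).trans ?_
    have : |t.1 - s| ≤ b - a := abs_le.2 ⟨by linarith [hs.2, t.2.1], by linarith [hs.1, t.2.2]⟩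
    change _ ≤ (K * (b - a)) ^ n / n.factorial * _
    gcongr
  -- The unique fixed point of a contracting iterate is fixed by the map itself.
  have hfix := hc.isFixedPt_fixedPoint_iterate
  set α := ContractingWith.fixedPoint _ hc
  have hα : Continuous (IccExtend hab α) := α.continuous.Icc_extend'
  refine ⟨IccExtend hab α, hα.continuousOn, h.intervalIntegrable hab hK hα.continuousOn,
    fun t ht => ?_⟩
  rw [IccExtend_of_mem hab _ ht]
  exact (DFunLike.congr_fun hfix ⟨t, ht⟩).symm

end IsCaratheodoryLipschitz

end Caratheodory

/-! ### The smallest eigenvalue and the pseudoinverse -/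

section Spectral

variable {d : ℕ} {A A' : Vec d →L[ℝ] Vec d}

theorem nonneg_of_hasEigenvalue_of_le {c μ : ℝ} (hA : ∀ x, c * ‖x‖ ^ 2 ≤ inner ℝ (A x) x)
    (hμ : Module.End.HasEigenvalue (A : Vec d →ₗ[ℝ] Vec d) μ) : c ≤ μ := by
  obtain ⟨x, hx⟩ := hμ.exists_hasEigenvector
  have h1 := hA x
  have h2 : A x = μ • x := hx.apply_eq_smul
  rw [h2, real_inner_smul_left, real_inner_self_eq_norm_sq] at h1
  have : 0 < ‖x‖ ^ 2 := by
    have := norm_pos_iff.2 hx.2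
    positivity
  exact le_of_mul_le_mul_right h1 this

theorem neg_norm_mul_sq_le_inner (A : Vec d →L[ℝ] Vec d) (x : Vec d) :
    -‖A‖ * ‖x‖ ^ 2 ≤ inner ℝ (A x) x := by
  have h1 := (abs_le.1 (abs_real_inner_le_norm (A x) x)).1
  have h2 : ‖A x‖ * ‖x‖ ≤ ‖A‖ * ‖x‖ * ‖x‖ := by gcongr; exact A.le_opNorm x
  nlinarith

/-- In finite dimension the infimum of the Rayleigh quotient is an eigenvalue. The lower bound
`-‖A‖` supplies the boundedness that both infima require. -/
theorem lambdaMin_mul_sq_le_inner (hd : 0 < d) (hA : (A : Vec d →ₗ[ℝ] Vec d).IsSymmetric)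
    (x : Vec d) : lambdaMin A * ‖x‖ ^ 2 ≤ inner ℝ (A x) x := by
  have : Nonempty (Fin d) := ⟨⟨0, hd⟩⟩
  rcases eq_or_ne x 0 with rfl | hx
  · simp
  have h1 := hA.hasEigenvalue_iInf_of_finiteDimensional
  have h2 : lambdaMin A ≤ _ :=
    csInf_le ⟨-‖A‖, fun μ hμ => nonneg_of_hasEigenvalue_of_le (neg_norm_mul_sq_le_inner A) hμ⟩ h1
  have hx' : 0 < ‖x‖ ^ 2 := by
    have := norm_pos_iff.2 hx
    positivity
  rw [← le_div_iff₀ hx']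
  refine h2.trans ?_
  refine (ciInf_le (f := fun x : { x : Vec d // x ≠ 0 } =>
    RCLike.re (inner ℝ (A x) x) / ‖(x : Vec d)‖ ^ 2) ⟨-‖A‖, ?_⟩ ⟨x, hx⟩)
  rintro _ ⟨z, rfl⟩
  have hz' : 0 < ‖(z : Vec d)‖ ^ 2 := by
    have := norm_pos_iff.2 z.2
    positivity
  exact (le_div_iff₀ hz').2 (neg_norm_mul_sq_le_inner A z)

theorem le_lambdaMin (hd : 0 < d) (hA : (A : Vec d →ₗ[ℝ] Vec d).IsSymmetric) {c : ℝ}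
    (h : ∀ x, c * ‖x‖ ^ 2 ≤ inner ℝ (A x) x) : c ≤ lambdaMin A := by
  have : Nonempty (Fin d) := ⟨⟨0, hd⟩⟩
  exact le_csInf ⟨_, hA.hasEigenvalue_iInf_of_finiteDimensional⟩
    fun μ hμ => nonneg_of_hasEigenvalue_of_le h hμ

/-- Weyl's inequality: the quadratic form of `A' - A` is at least `-‖A' - A‖ ‖x‖²`. -/
theorem lambdaMin_sub_norm_sub_le (hd : 0 < d) (hA : (A : Vec d →ₗ[ℝ] Vec d).IsSymmetric)
    (hA' : (A' : Vec d →ₗ[ℝ] Vec d).IsSymmetric) : lambdaMin A - ‖A' - A‖ ≤ lambdaMin A' := by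
  refine le_lambdaMin hd hA' fun x => ?_
  have h1 := lambdaMin_mul_sq_le_inner hd hA x
  have h2 := neg_norm_mul_sq_le_inner (A' - A) x
  rw [sub_apply, inner_sub_left] at h2
  linarith

/-- The spectrum is finite and nonempty, so the infimum is attained; if it were zero, `A` would have
a kernel vector. -/
theorem lambdaMin_pos (hd : 0 < d) (hA : (A : Vec d →ₗ[ℝ] Vec d).IsSymmetric)
    (hpos : ∀ x, 0 ≤ inner ℝ (A x) x) (hinv : IsUnit A) : 0 < lambdaMin A := by
  have : Nonempty (Fin d) := ⟨⟨0, hd⟩⟩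
  have hne : {μ : ℝ | Module.End.HasEigenvalue (A : Vec d →ₗ[ℝ] Vec d) μ}.Nonempty :=
    ⟨_, hA.hasEigenvalue_iInf_of_finiteDimensional⟩
  have hfin : {μ : ℝ | Module.End.HasEigenvalue (A : Vec d →ₗ[ℝ] Vec d) μ}.Finite :=
    Module.End.finite_hasEigenvalue _
  have hmem := hne.csInf_mem hfin
  refine lt_of_le_of_ne (le_lambdaMin hd hA (by simpa using hpos)) fun h0 => ?_
  obtain ⟨x, hx⟩ := Module.End.HasEigenvalue.exists_hasEigenvector hmem
  have hx1 : A x = lambdaMin A • x := hx.apply_eq_smul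
  rw [← h0, zero_smul] at hx1
  obtain ⟨X, hX⟩ := hinv.exists_left_inv
  apply hx.2
  have : (X * A) x = x := by rw [hX]; rfl
  rw [← this]
  simp [hx1]

theorem comp_pseudoinverse_of_isUnit (hA : IsUnit A) : A ∘L pseudoinverse A = .id ℝ (Vec d) := by
  obtain ⟨X, hX⟩ := hA.exists_left_inv
  obtain ⟨Y, hY⟩ := hA.exists_right_inv
  have hXY : X = Y := left_inv_eq_right_inv hX hY
  subst hXY
  have hex : ∃ X, IsPseudoinverse A X := by
    have h1 : A ∘L X = 1 := hY
    have h2 : X ∘L A = 1 := hX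
    refine ⟨X, ?_, ?_, ?_, ?_⟩
    · rw [h2]; rfl
    · rw [h1]; rfl
    · rw [h1]; exact ContinuousLinearMap.adjoint_id
    · rw [h2]; exact ContinuousLinearMap.adjoint_id
  -- The first Penrose equation suffices: cancelling `A` makes any chosen pseudoinverse a right
  -- inverse.
  have h := hex.choose_spec.mul_mul_left
  rw [pseudoinverse, dif_pos hex]
  have h3 : A * (hex.choose * A) = A := h
  calc A * hex.choose = A * (hex.choose * A) * X := by rw [mul_assoc, mul_assoc, hY, mul_one]
    _ = 1 := by rw [h3, hY]

/-- Coercivity gives `c ‖x‖ ≤ ‖A x‖`, hence invertibility; the bound is this inequality at `x = A†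
y`. -/
theorem norm_pseudoinverse_apply_le (hd : 0 < d) (hA : (A : Vec d →ₗ[ℝ] Vec d).IsSymmetric) {c : ℝ}
    (hc : 0 < c) (h : c ≤ lambdaMin A) (y : Vec d) : ‖pseudoinverse A y‖ ≤ c⁻¹ * ‖y‖ := by
  have hlow : ∀ x, c * ‖x‖ ≤ ‖A x‖ := by
    intro x
    rcases eq_or_ne x 0 with rfl | hx
    · simp
    have h1 := lambdaMin_mul_sq_le_inner hd hA x
    have h2 := real_inner_le_norm (A x) x
    have hx' := norm_pos_iff.2 hx
    have h3 : c * ‖x‖ ^ 2 ≤ lambdaMin A * ‖x‖ ^ 2 := by gcongr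
    refine le_of_mul_le_mul_right ?_ hx'
    nlinarith
  have hinj : Function.Injective (A : Vec d →ₗ[ℝ] Vec d) := by
    rw [← LinearMap.ker_eq_bot, LinearMap.ker_eq_bot']
    intro x hx
    have h1 := hlow x
    have h2 : A x = 0 := hx
    rw [h2, norm_zero] at h1
    have := norm_nonneg x
    exact norm_eq_zero.1 (by nlinarith)
  have hunit : IsUnit A := by
    let e := (LinearEquiv.ofInjectiveEndo _ hinj).toContinuousLinearEquiv
    refine ⟨ContinuousLinearEquiv.toUnit e, ?_⟩
    ext x : 1
    rfl
  have h1 : A (pseudoinverse A y) = y :=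
    DFunLike.congr_fun (comp_pseudoinverse_of_isUnit hunit) y
  have h2 := hlow (pseudoinverse A y)
  rw [h1] at h2
  rwa [inv_mul_eq_div, le_div_iff₀' hc]

end Spectral

/-! ### The flow of the drift -/

/-! ### Measurable dependence of operators and derivatives on a parameter -/

section Measurability

theorem MeasureTheory.MemLp.ae_norm_le_toReal_eLpNorm {α E : Type*} [MeasurableSpace α]
    [NormedAddCommGroup E] {μ : Measure α} {f : α → E} (hf : MemLp f ∞ μ) :
    ∀ᵐ t ∂μ, ‖f t‖ ≤ (eLpNorm f ∞ μ).toReal := by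
  have h := hf.eLpNorm_ne_top
  rw [eLpNorm_exponent_top] at h ⊢
  filter_upwards [ae_le_eLpNormEssSup (f := f) (μ := μ)] with t ht
  rw [← toReal_enorm]
  exact ENNReal.toReal_mono h ht

variable {α : Type*} [MeasurableSpace α] {μ : Measure α} {n : ℕ}
  {F : Type*} [NormedAddCommGroup F] [NormedSpace ℝ F]

theorem aestronglyMeasurable_clm_of_apply {A : α → Vec n →L[ℝ] F}
    (hA : ∀ v, AEStronglyMeasurable (fun t => A t v) μ) : AEStronglyMeasurable A μ := by
  have : A = fun t => ∑ j : Fin n,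
      ContinuousLinearMap.smulRightL ℝ (Vec n) F (EuclideanSpace.proj j)
        (A t (EuclideanSpace.basisFun (Fin n) ℝ j)) := by
    ext t v
    conv_lhs => rw [← (EuclideanSpace.basisFun (Fin n) ℝ).sum_repr v]
    simp [map_sum]
  rw [this]
  exact Finset.aestronglyMeasurable_fun_sum _ fun j _ =>
    (ContinuousLinearMap.continuous _).comp_aestronglyMeasurable (hA _)

theorem aestronglyMeasurable_fderiv {f : α → Vec n → F} {c : Vec n}
    (hf : ∀ c, AEStronglyMeasurable (fun t => f t c) μ)
    (hd : ∀ᵐ t ∂μ, DifferentiableAt ℝ (f t) c) :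
    AEStronglyMeasurable (fun t => fderiv ℝ (f t) c) μ := by
  refine aestronglyMeasurable_clm_of_apply fun v => ?_
  refine aestronglyMeasurable_of_tendsto_ae (u := atTop)
    (f := fun (m : ℕ) t => (m : ℝ) • (f t (c + (m : ℝ)⁻¹ • v) - f t c)) (fun m => ?_) ?_
  · exact ((hf _).sub (hf _)).const_smul _
  · filter_upwards [hd] with t ht
    exact (ht.hasFDerivAt.lim_real v).comp tendsto_natCast_atTop_atTop

end Measurability

namespace IsPrimitiveOn

variable {E F : Type*} [NormedAddCommGroup E] [NormedSpace ℝ E] [NormedAddCommGroup F]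
  [NormedSpace ℝ F] {x y f g : ℝ → E} {a b s : ℝ} {p : E}

theorem congr (h : IsPrimitiveOn x f a b s p) (hs : s ∈ Icc a b) (hxy : EqOn y x (Icc a b))
    (hfg : EqOn g f (Icc a b)) : IsPrimitiveOn y g a b s p where
  continuousOn := h.continuousOn.congr hxy
  intervalIntegrable := h.intervalIntegrable.congr fun t ht => by
    rw [uIoc_of_le (hs.1.trans hs.2)] at ht
    exact (hfg (Ioc_subset_Icc_self ht)).symm
  eq_integral t ht := by
    rw [hxy ht, h.eq_integral t ht, intervalIntegral.integral_congr fun r hr =>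
      hfg (uIcc_subset_Icc hs ht hr)]

theorem clm_apply [CompleteSpace E] [CompleteSpace F] (h : IsPrimitiveOn x f a b s p)
    (hs : s ∈ Icc a b) (A : E →L[ℝ] F) :
    IsPrimitiveOn (fun t => A (x t)) (fun t => A (f t)) a b s (A p) where
  continuousOn := A.continuous.comp_continuousOn h.continuousOn
  intervalIntegrable := ⟨A.integrable_comp h.intervalIntegrable.1,
    A.integrable_comp h.intervalIntegrable.2⟩
  eq_integral t ht := by
    rw [h.eq_integral t ht, map_add,
      A.intervalIntegral_comp_comm (h.intervalIntegrable.mono_Icc hs ht)]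

end IsPrimitiveOn

/-- `odeSolution` is an arbitrary choice; existence makes it satisfy the integral equation, the only
property used later. -/
theorem IsCaratheodoryLipschitz.isPrimitiveOn_odeSolution {d : ℕ} {f : ℝ → Vec d → Vec d}
    {a b K M s : ℝ} (h : IsCaratheodoryLipschitz f a b K M) (hK : 0 ≤ K) (hs : s ∈ Icc a b)
    (p : Vec d) :
    IsPrimitiveOn (odeSolution f a b s p) (fun r => f r (odeSolution f a b s p r)) a b s p := by
  obtain ⟨x, hx⟩ := h.exists_isPrimitiveOn hK hs p
  have hex : ∃ x, IsODESolution f a b s p x :=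
    ⟨x, hx.continuousOn, hx.intervalIntegrable, hx.eq_integral⟩
  rw [odeSolution, dif_pos hex]
  exact ⟨hex.choose_spec.continuousOn, hex.choose_spec.intervalIntegrable,
    hex.choose_spec.eq_integral⟩

namespace ControlSystem

variable {d k : ℕ} {S : ControlSystem d k} {Λ₁ Λ₂ L_B : ℝ}

theorem timeMeasure_eq (S : ControlSystem d k) :
    S.timeMeasure = volume.restrict (Icc S.t₀ S.T) :=
  Measure.restrict_congr_set Ioo_ae_eq_Icc

namespace Regular

theorem left_mem (hS : S.Regular Λ₁ Λ₂ L_B) : S.t₀ ∈ Icc S.t₀ S.T := left_mem_Icc.2 hS.time_lt.le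

theorem tau_mem (hS : S.Regular Λ₁ Λ₂ L_B) (i : Fin 2) : S.tau i ∈ Icc S.t₀ S.T := by
  unfold tau
  split_ifs
  · exact left_mem_Icc.2 hS.time_lt.le
  · exact right_mem_Icc.2 hS.time_lt.le

theorem differentiable_drift (hS : S.Regular Λ₁ Λ₂ L_B) {t : ℝ} (ht : t ∈ Icc S.t₀ S.T) :
    Differentiable ℝ (S.N t) :=
  (hS.drift_contDiff t ht).differentiable (by norm_num)

theorem norm_drift_sub_le (hS : S.Regular Λ₁ Λ₂ L_B) {t : ℝ} (ht : t ∈ Icc S.t₀ S.T)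
    (x y : Vec d) : ‖S.N t x - S.N t y‖ ≤ Λ₁ * ‖x - y‖ :=
  convex_univ.norm_image_sub_le_of_norm_fderiv_le
    (fun z _ => hS.differentiable_drift ht z) (fun z _ => hS.drift_fderiv_le t ht z)
    (mem_univ y) (mem_univ x)

theorem norm_fderiv_drift_sub_le (hS : S.Regular Λ₁ Λ₂ L_B) {t : ℝ} (ht : t ∈ Icc S.t₀ S.T)
    (x y : Vec d) : ‖fderiv ℝ (S.N t) x - fderiv ℝ (S.N t) y‖ ≤ Λ₂ * ‖x - y‖ := by
  have h : ContDiff ℝ 1 (fderiv ℝ (S.N t)) :=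
    (hS.drift_contDiff t ht).fderiv_right (by norm_num)
  exact convex_univ.norm_image_sub_le_of_norm_fderiv_le
    (fun z _ => h.differentiable (by norm_num) z)
    (fun z _ => hS.drift_fderiv_fderiv_le t ht z) (mem_univ y) (mem_univ x)

/-- Mean value inequality on the segment, where `DN_t` differs from its value at `y` by at most `Λ₂
‖x - y‖`. The sharp factor 1/2 is not needed. -/
theorem norm_drift_sub_sub_fderiv_le (hS : S.Regular Λ₁ Λ₂ L_B) {t : ℝ} (ht : t ∈ Icc S.t₀ S.T)
    (x y : Vec d) :
    ‖S.N t x - S.N t y - fderiv ℝ (S.N t) y (x - y)‖ ≤ Λ₂ * ‖x - y‖ * ‖x - y‖ := by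
  refine (convex_segment y x).norm_image_sub_le_of_norm_fderiv_le' (𝕜 := ℝ)
    (fun z _ => hS.differentiable_drift ht z) (fun z hz => ?_)
    (left_mem_segment ℝ y x) (right_mem_segment ℝ y x)
  refine (hS.norm_fderiv_drift_sub_le ht z y).trans ?_
  have := hS.Λ₂_pos
  gcongr
  obtain ⟨c, hc, rfl⟩ := (segment_eq_image' ℝ y x).subset hz
  rw [add_sub_cancel_left, norm_smul, Real.norm_of_nonneg hc.1]
  exact mul_le_of_le_one_left (norm_nonneg _) hc.2

theorem isCaratheodoryLipschitz_drift (hS : S.Regular Λ₁ Λ₂ L_B) :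
    IsCaratheodoryLipschitz S.N S.t₀ S.T Λ₁
      (eLpNorm (fun t => S.N t 0) ∞ S.timeMeasure).toReal where
  aestronglyMeasurable c := S.timeMeasure_eq ▸ (hS.drift_memLp c).1
  norm_sub_le := (ae_restrict_mem measurableSet_Icc).mono fun _ ht => hS.norm_drift_sub_le ht
  norm_zero_le := S.timeMeasure_eq ▸ (hS.drift_memLp 0).ae_norm_le_toReal_eLpNorm

theorem isPrimitiveOn_flow (hS : S.Regular Λ₁ Λ₂ L_B) {s : ℝ} (hs : s ∈ Icc S.t₀ S.T)
    (p : Vec d) :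
    IsPrimitiveOn (fun r => S.flow s r p) (fun r => S.N r (S.flow s r p)) S.t₀ S.T s p :=
  hS.isCaratheodoryLipschitz_drift.isPrimitiveOn_odeSolution hS.Λ₁_pos.le hs p

theorem norm_flow_sub_le (hS : S.Regular Λ₁ Λ₂ L_B) {s s' r : ℝ} (hs : s ∈ Icc S.t₀ S.T)
    (hs' : s' ∈ Icc S.t₀ S.T) (hr : r ∈ Icc S.t₀ S.T) (p p' : Vec d) :
    ‖S.flow s r p - S.flow s' r p'‖ ≤
      ‖p - S.flow s' s p'‖ * Real.exp (Λ₁ * (S.T - S.t₀)) := by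
  have h := (hS.isPrimitiveOn_flow hs p).norm_sub_le
    ((hS.isPrimitiveOn_flow hs' p').restart hs' hs) hs hS.Λ₁_pos.le le_rfl
    ((ae_restrict_mem measurableSet_Icc).mono fun t ht => by
      rw [add_zero]; exact hS.norm_drift_sub_le ht _ _) r hr
  simpa using h

theorem isCaratheodoryLipschitz_variation (hS : S.Regular Λ₁ Λ₂ L_B) {x : ℝ → Vec d}
    (hx : ContinuousOn x (Icc S.t₀ S.T)) :
    IsCaratheodoryLipschitz
      (fun t (W : Vec d →L[ℝ] Vec d) => fderiv ℝ (S.N t) (x t) ∘L W) S.t₀ S.T Λ₁ 0 where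
  aestronglyMeasurable W := by
    have h : AEStronglyMeasurable (fun t => fderiv ℝ (S.N t) (x t))
        (volume.restrict (Icc S.t₀ S.T)) := by
      refine aestronglyMeasurable_apply_of_continuous (fun c => ?_) ?_
        (hx.aestronglyMeasurable measurableSet_Icc)
      · exact aestronglyMeasurable_fderiv
          hS.isCaratheodoryLipschitz_drift.aestronglyMeasurable
          ((ae_restrict_mem measurableSet_Icc).mono fun t ht => hS.differentiable_drift ht c)
      · exact (ae_restrict_mem measurableSet_Icc).mono fun t ht =>
          (hS.drift_contDiff t ht).continuous_fderiv (by norm_num)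
    exact (((ContinuousLinearMap.compL ℝ (Vec d) (Vec d) (Vec d)).flip W).continuous
      ).comp_aestronglyMeasurable h
  norm_sub_le := (ae_restrict_mem measurableSet_Icc).mono fun t ht W W' => by
    rw [← ContinuousLinearMap.comp_sub]
    exact (ContinuousLinearMap.opNorm_comp_le _ _).trans
      (by gcongr; exact hS.drift_fderiv_le t ht _)
  norm_zero_le := by simp

/-- Compare `Φ(p + h)` with `Φ(p) + W h`: the latter solves the drift equation up to a Taylor
remainder of order `‖h‖²`, and Grönwall preserves that order. -/
theorem hasFDerivAt_flow (hS : S.Regular Λ₁ Λ₂ L_B) {s r : ℝ} (hs : s ∈ Icc S.t₀ S.T)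
    (hr : r ∈ Icc S.t₀ S.T) {p : Vec d} {W : ℝ → Vec d →L[ℝ] Vec d}
    (hW : IsPrimitiveOn W (fun t => fderiv ℝ (S.N t) (S.flow s t p) ∘L W t) S.t₀ S.T s
      (.id ℝ (Vec d))) :
    HasFDerivAt (S.flow s r) (W r) p := by
  set c := Real.exp (Λ₁ * (S.T - S.t₀))
  have h0 : 0 ≤ S.T - S.t₀ := sub_nonneg.2 hS.time_lt.le
  have h2 := hS.Λ₂_pos.le
  have key : ∀ h : Vec d, ‖S.flow s r (p + h) - S.flow s r p - W r h‖ ≤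
      (Λ₂ * c * c * (S.T - S.t₀) * c) * ‖‖h‖ ^ 2‖ := by
    intro h
    have hy := (hS.isPrimitiveOn_flow hs p).add
      (hW.clm_apply hs (ContinuousLinearMap.apply ℝ (Vec d) h)) hs
    have h3 := (hS.isPrimitiveOn_flow hs (p + h)).norm_sub_le hy hs hS.Λ₁_pos.le
      (ε := Λ₂ * (‖h‖ * c) * (‖h‖ * c)) (by positivity) (by
        filter_upwards [ae_restrict_mem measurableSet_Icc] with t ht
        set x := S.flow s t (p + h)
        set z := S.flow s t p
        have h4 : ‖x - z‖ ≤ ‖h‖ * c := by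
          have := hS.norm_flow_sub_le hs hs ht (p + h) p
          rwa [(hS.isPrimitiveOn_flow hs p).apply_base hs, add_sub_cancel_left] at this
        have h5 : S.N t x - (S.N t z + (fderiv ℝ (S.N t) z ∘L W t) h) =
            fderiv ℝ (S.N t) z (x - (z + W t h)) +
              (S.N t x - S.N t z - fderiv ℝ (S.N t) z (x - z)) := by
          simp only [map_sub, map_add, ContinuousLinearMap.comp_apply]
          abel
        change ‖S.N t x - (S.N t z + (fderiv ℝ (S.N t) z ∘L W t) h)‖ ≤
          Λ₁ * ‖x - (z + W t h)‖ + _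
        rw [h5]
        refine (norm_add_le _ _).trans (add_le_add ?_ ?_)
        · exact ContinuousLinearMap.le_of_opNorm_le _ (hS.drift_fderiv_le t ht z) _
        · exact (hS.norm_drift_sub_sub_fderiv_le ht x z).trans (by gcongr)) r hr
    rw [norm_pow, norm_norm]
    have h6 : (ContinuousLinearMap.apply ℝ (Vec d) h) (ContinuousLinearMap.id ℝ (Vec d)) = h := rfl
    rw [h6, sub_self, norm_zero, zero_add] at h3
    calc ‖S.flow s r (p + h) - S.flow s r p - W r h‖
        = ‖S.flow s r (p + h) - (S.flow s r p + W r h)‖ := by rw [sub_sub]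
      _ ≤ _ := h3
      _ = _ := by ring
  rw [hasFDerivAt_iff_isLittleO_nhds_zero]
  exact (Asymptotics.IsBigO.of_bound _ (Eventually.of_forall key)).trans_isLittleO
    (Asymptotics.isLittleO_norm_pow_id one_lt_two)

theorem isPrimitiveOn_fderiv_flow (hS : S.Regular Λ₁ Λ₂ L_B) {s : ℝ} (hs : s ∈ Icc S.t₀ S.T)
    (p : Vec d) :
    IsPrimitiveOn (fun r => fderiv ℝ (S.flow s r) p)
      (fun r => fderiv ℝ (S.N r) (S.flow s r p) ∘L fderiv ℝ (S.flow s r) p) S.t₀ S.T s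
      (.id ℝ (Vec d)) := by
  obtain ⟨W, hW⟩ := (hS.isCaratheodoryLipschitz_variation
    (hS.isPrimitiveOn_flow hs p).continuousOn).exists_isPrimitiveOn hS.Λ₁_pos.le hs
    (.id ℝ (Vec d))
  refine hW.congr hs (fun r hr => (hS.hasFDerivAt_flow hs hr hW).fderiv) fun r hr => ?_
  simp only [(hS.hasFDerivAt_flow hs hr hW).fderiv]

theorem norm_fderiv_flow_le (hS : S.Regular Λ₁ Λ₂ L_B) {s r : ℝ} (hs : s ∈ Icc S.t₀ S.T)
    (hr : r ∈ Icc S.t₀ S.T) (p : Vec d) :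
    ‖fderiv ℝ (S.flow s r) p‖ ≤ Real.exp (Λ₁ * (S.T - S.t₀)) := by
  have hlip : LipschitzWith (Real.exp (Λ₁ * (S.T - S.t₀))).toNNReal (S.flow s r) :=
    LipschitzWith.of_dist_le' fun x y => by
      rw [dist_eq_norm, dist_eq_norm, mul_comm]
      have := hS.norm_flow_sub_le hs hs hr x y
      rwa [(hS.isPrimitiveOn_flow hs y).apply_base hs] at this
  have := norm_fderiv_le_of_lipschitz ℝ hlip (x₀ := p)
  rwa [Real.coe_toNNReal _ (Real.exp_pos _).le] at this

/-- Two variational equations are compared through `A W - A' W' = A (W - W') + (A - A') W'`, with `A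
- A'` controlled by `Λ₂`. Distinct initial times are allowed because the kernel differentiates the
flow with respect to its base point at a varying time. -/
theorem norm_fderiv_flow_sub_le (hS : S.Regular Λ₁ Λ₂ L_B) {s s' r : ℝ}
    (hs : s ∈ Icc S.t₀ S.T) (hs' : s' ∈ Icc S.t₀ S.T) (hr : r ∈ Icc S.t₀ S.T) (p p' : Vec d) :
    ‖fderiv ℝ (S.flow s r) p - fderiv ℝ (S.flow s' r) p'‖ ≤
      (‖ContinuousLinearMap.id ℝ (Vec d) - fderiv ℝ (S.flow s' s) p'‖ +
        Λ₂ * (‖p - S.flow s' s p'‖ * Real.exp (Λ₁ * (S.T - S.t₀))) *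
          Real.exp (Λ₁ * (S.T - S.t₀)) * (S.T - S.t₀)) * Real.exp (Λ₁ * (S.T - S.t₀)) := by
  have h2 := hS.Λ₂_pos.le
  refine (hS.isPrimitiveOn_fderiv_flow hs p).norm_sub_le
    ((hS.isPrimitiveOn_fderiv_flow hs' p').restart hs' hs) hs hS.Λ₁_pos.le (by positivity) ?_ r hr
  filter_upwards [ae_restrict_mem measurableSet_Icc] with t ht
  set A := fderiv ℝ (S.N t) (S.flow s t p)
  set A' := fderiv ℝ (S.N t) (S.flow s' t p')
  set W := fderiv ℝ (S.flow s t) p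
  set W' := fderiv ℝ (S.flow s' t) p'
  have h1 : A ∘L W - A' ∘L W' = A ∘L (W - W') + (A - A') ∘L W' := by
    rw [ContinuousLinearMap.comp_sub, ContinuousLinearMap.sub_comp]
    abel
  rw [h1]
  refine (norm_add_le _ _).trans (add_le_add ?_ ?_)
  · refine (ContinuousLinearMap.opNorm_comp_le _ _).trans ?_
    gcongr
    exact hS.drift_fderiv_le t ht _
  · refine (ContinuousLinearMap.opNorm_comp_le _ _).trans ?_
    gcongr
    · exact (hS.norm_fderiv_drift_sub_le ht _ _).trans
        (by gcongr; exact hS.norm_flow_sub_le hs hs' ht p p')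
    · exact hS.norm_fderiv_flow_le hs' ht p'

theorem continuousOn_fderiv_flow (hS : S.Regular Λ₁ Λ₂ L_B) {r : ℝ} (hr : r ∈ Icc S.t₀ S.T)
    {x : ℝ → Vec d} (hx : ContinuousOn x (Icc S.t₀ S.T)) :
    ContinuousOn (fun t => fderiv ℝ (S.flow t r) (x t)) (Icc S.t₀ S.T) := by
  intro s hs
  set e := Real.exp (Λ₁ * (S.T - S.t₀))
  have hW := hS.isPrimitiveOn_fderiv_flow hs (x s)
  have hX := hS.isPrimitiveOn_flow hs (x s)
  -- This majorant vanishes at `t = s`, where the flow is the identity.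
  have hcont : ContinuousOn (fun t =>
      (‖ContinuousLinearMap.id ℝ (Vec d) - fderiv ℝ (S.flow s t) (x s)‖ +
        Λ₂ * (‖x t - S.flow s t (x s)‖ * e) * e * (S.T - S.t₀)) * e) (Icc S.t₀ S.T) := by
    have h1 := (continuousOn_const (c := ContinuousLinearMap.id ℝ (Vec d))).sub hW.continuousOn
    have h2 := hx.sub hX.continuousOn
    exact (h1.norm.add (((continuousOn_const.mul (h2.norm.mul continuousOn_const)).mul
      continuousOn_const).mul continuousOn_const)).mul continuousOn_const
  have h0 := hcont s hs
  rw [ContinuousWithinAt, hW.apply_base hs, hX.apply_base hs] at h0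
  simp only [sub_self, norm_zero, zero_mul, mul_zero, add_zero] at h0
  rw [ContinuousWithinAt, tendsto_iff_norm_sub_tendsto_zero]
  refine squeeze_zero' (Eventually.of_forall fun _ => norm_nonneg _) ?_ h0
  filter_upwards [self_mem_nhdsWithin] with t ht
  exact hS.norm_fderiv_flow_sub_le ht hs hr (x t) (x s)

end Regular

end ControlSystem

/-! ### Trajectories, the Gramian map and the synthesis map -/

namespace ControlSystem

variable {d k : ℕ} {S : ControlSystem d k} {Λ₁ Λ₂ L_B : ℝ}

theorem ae_norm_control_le (u : S.Control) :
    ∀ᵐ t ∂volume.restrict (Icc S.t₀ S.T), ‖u t‖ ≤ ‖u‖ := by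
  rw [← S.timeMeasure_eq, Lp.norm_def]
  exact (Lp.memLp u).ae_norm_le_toReal_eLpNorm

theorem ae_norm_control_sub_le (u v : S.Control) :
    ∀ᵐ t ∂volume.restrict (Icc S.t₀ S.T), ‖u t - v t‖ ≤ ‖u - v‖ := by
  have h := ae_norm_control_le (u - v)
  rw [← S.timeMeasure_eq] at h ⊢
  filter_upwards [h, Lp.coeFn_sub u v] with t h1 h2
  rwa [h2] at h1

theorem inputNorm_nonneg (S : ControlSystem d k) : 0 ≤ S.inputNorm := ENNReal.toReal_nonneg

theorem zeta_nonneg (S : ControlSystem d k) {C : ℝ} (hC : 0 ≤ C) (y : Vec d) :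
    0 ≤ S.zeta Λ₁ C y := by
  have := S.inputNorm_nonneg
  unfold zeta
  positivity

namespace Regular

theorem norm_input_sub_le (hS : S.Regular Λ₁ Λ₂ L_B) {t : ℝ} (ht : t ∈ Icc S.t₀ S.T)
    (x y : Vec d) : ‖S.B t x - S.B t y‖ ≤ L_B * ‖x - y‖ :=
  convex_univ.norm_image_sub_le_of_norm_fderiv_le
    (fun z _ => (hS.input_contDiff t ht).differentiable (by norm_num) z)
    (fun z _ => hS.input_fderiv_le t ht z) (mem_univ y) (mem_univ x)

/-- Fubini gives the bound for almost every `x` only; a set of full measure is dense, and continuity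
of `B(t, ·)` extends it to all `x`. Without this, nothing could be said along a trajectory. -/
theorem ae_norm_input_le (hS : S.Regular Λ₁ Λ₂ L_B) :
    ∀ᵐ t ∂volume.restrict (Icc S.t₀ S.T), ∀ x, ‖S.B t x‖ ≤ S.inputNorm := by
  have h : ∀ᵐ z ∂(volume.restrict (Icc S.t₀ S.T)).prod (volume : Measure (Vec d)),
      ‖Function.uncurry S.B z‖ ≤ S.inputNorm := by
    rw [← S.timeMeasure_eq]
    exact hS.input_memLp.ae_norm_le_toReal_eLpNorm
  filter_upwards [Measure.ae_ae_of_ae_prod h, ae_restrict_mem measurableSet_Icc] with t h1 ht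
  intro x
  have hclosed : IsClosed {x | ‖S.B t x‖ ≤ S.inputNorm} :=
    isClosed_le (hS.input_contDiff t ht).continuous.norm continuous_const
  have hdense : Dense {x | ‖S.B t x‖ ≤ S.inputNorm} := Measure.dense_of_ae h1
  exact hclosed.closure_subset_iff.2 Subset.rfl (hdense x)

theorem aestronglyMeasurable_input (hS : S.Regular Λ₁ Λ₂ L_B) (x : Vec d) :
    AEStronglyMeasurable (fun t => S.B t x) (volume.restrict (Icc S.t₀ S.T)) := by
  have h := hS.input_memLp.1
  rw [timeSpaceMeasure, S.timeMeasure_eq] at h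
  have hdense := Measure.dense_of_ae h.prod_swap.prodMk_left
  obtain ⟨z, hz, hzx⟩ := mem_closure_iff_seq_limit.1 (hdense x)
  refine aestronglyMeasurable_of_tendsto_ae (u := atTop) (f := fun n t => S.B t (z n)) hz ?_
  filter_upwards [ae_restrict_mem measurableSet_Icc] with t ht
  exact ((hS.input_contDiff t ht).continuous.tendsto x).comp hzx

theorem isCaratheodoryLipschitz_control (hS : S.Regular Λ₁ Λ₂ L_B) (u : S.Control) :
    IsCaratheodoryLipschitz (fun t x => S.N t x + S.B t x (u t)) S.t₀ S.T (Λ₁ + L_B * ‖u‖)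
      ((eLpNorm (fun t => S.N t 0) ∞ S.timeMeasure).toReal + S.inputNorm * ‖u‖) where
  aestronglyMeasurable c := by
    have hu : AEStronglyMeasurable u (volume.restrict (Icc S.t₀ S.T)) :=
      S.timeMeasure_eq ▸ Lp.aestronglyMeasurable u
    exact (hS.isCaratheodoryLipschitz_drift.aestronglyMeasurable c).add
      (isBoundedBilinearMap_apply.continuous.comp_aestronglyMeasurable
        ((hS.aestronglyMeasurable_input c).prodMk hu))
  norm_sub_le := by
    filter_upwards [ae_norm_control_le u, ae_restrict_mem measurableSet_Icc] with t hu ht x y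
    have h1 : S.N t x + S.B t x (u t) - (S.N t y + S.B t y (u t)) =
        (S.N t x - S.N t y) + (S.B t x - S.B t y) (u t) := by
      rw [sub_apply]; abel
    rw [h1]
    calc _ ≤ ‖S.N t x - S.N t y‖ + ‖(S.B t x - S.B t y) (u t)‖ := norm_add_le _ _
      _ ≤ Λ₁ * ‖x - y‖ + (L_B * ‖x - y‖) * ‖u‖ := add_le_add (hS.norm_drift_sub_le ht x y)
          (ContinuousLinearMap.le_of_opNorm_le_of_le _ (hS.norm_input_sub_le ht x y) hu)
      _ = _ := by ring
  norm_zero_le := by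
    filter_upwards [ae_norm_control_le u, hS.isCaratheodoryLipschitz_drift.norm_zero_le,
      hS.ae_norm_input_le] with t hu hN hB
    exact (norm_add_le _ _).trans (add_le_add hN
      (ContinuousLinearMap.le_of_opNorm_le_of_le _ (hB 0) hu))

theorem isPrimitiveOn_trajectory (hS : S.Regular Λ₁ Λ₂ L_B) (x₀ : Vec d) (u : S.Control) :
    IsPrimitiveOn (S.trajectory x₀ u)
      (fun r => S.N r (S.trajectory x₀ u r) + S.B r (S.trajectory x₀ u r) (u r))
      S.t₀ S.T S.t₀ x₀ := by
  have := hS.L_B_nonneg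
  have := hS.Λ₁_pos
  exact (hS.isCaratheodoryLipschitz_control u).isPrimitiveOn_odeSolution (by positivity)
    hS.left_mem x₀

/-- Splitting `B(x)u - B(y)v` as `(B(x) - B(y))u + B(y)(u - v)` puts only `‖u‖` into the Grönwall
rate. -/
theorem norm_trajectory_sub_le (hS : S.Regular Λ₁ Λ₂ L_B) (x₀ : Vec d) {R : ℝ} (hR : 0 ≤ R)
    {u v : S.Control} (hu : ‖u‖ ≤ R) {t : ℝ} (ht : t ∈ Icc S.t₀ S.T) :
    ‖S.trajectory x₀ u t - S.trajectory x₀ v t‖ ≤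
      S.inputNorm * (S.T - S.t₀) * Real.exp ((Λ₁ + L_B * R) * (S.T - S.t₀)) * ‖u - v‖ := by
  have hL := hS.L_B_nonneg
  have hΛ := hS.Λ₁_pos
  have hβ := S.inputNorm_nonneg
  have h := (hS.isPrimitiveOn_trajectory x₀ u).norm_sub_le (hS.isPrimitiveOn_trajectory x₀ v)
    hS.left_mem (K := Λ₁ + L_B * R) (ε := S.inputNorm * ‖u - v‖) (by positivity) (by positivity)
    (by
      filter_upwards [ae_norm_control_le u, ae_norm_control_sub_le u v, hS.ae_norm_input_le,
        ae_restrict_mem measurableSet_Icc] with r hur huv hB hr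
      set x := S.trajectory x₀ u r
      set y := S.trajectory x₀ v r
      have h1 : S.N r x + S.B r x (u r) - (S.N r y + S.B r y (v r)) =
          (S.N r x - S.N r y) + (S.B r x - S.B r y) (u r) + S.B r y (u r - v r) := by
        rw [sub_apply, map_sub]; abel
      rw [h1]
      calc _ ≤ ‖S.N r x - S.N r y‖ + ‖(S.B r x - S.B r y) (u r)‖ + ‖S.B r y (u r - v r)‖ :=
            norm_add₃_le
        _ ≤ Λ₁ * ‖x - y‖ + (L_B * ‖x - y‖) * R + S.inputNorm * ‖u - v‖ :=
            add_le_add (add_le_add (hS.norm_drift_sub_le hr x y)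
              (ContinuousLinearMap.le_of_opNorm_le_of_le _ (hS.norm_input_sub_le hr x y)
                (hur.trans hu)))
              (ContinuousLinearMap.le_of_opNorm_le_of_le _ (hB y) huv)
        _ = _ := by ring) t ht
  refine h.trans_eq ?_
  rw [sub_self, norm_zero]
  ring

theorem aestronglyMeasurable_kernel (hS : S.Regular Λ₁ Λ₂ L_B) (i : Fin 2) (x₀ : Vec d)
    (u : S.Control) :
    AEStronglyMeasurable (S.kernel i x₀ u) (volume.restrict (Icc S.t₀ S.T)) := by
  have hx := (hS.isPrimitiveOn_trajectory x₀ u).continuousOn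
  have h1 := (hS.continuousOn_fderiv_flow (hS.tau_mem i) hx).aestronglyMeasurable
    (μ := volume) measurableSet_Icc
  have h2 : AEStronglyMeasurable (fun t => S.B t (S.trajectory x₀ u t))
      (volume.restrict (Icc S.t₀ S.T)) :=
    aestronglyMeasurable_apply_of_continuous hS.aestronglyMeasurable_input
      ((ae_restrict_mem measurableSet_Icc).mono fun t ht => (hS.input_contDiff t ht).continuous)
      (hx.aestronglyMeasurable measurableSet_Icc)
  exact isBoundedBilinearMap_comp.continuous.comp_aestronglyMeasurable (h1.prodMk h2)

theorem ae_norm_kernel_le (hS : S.Regular Λ₁ Λ₂ L_B) (i : Fin 2) (x₀ : Vec d) (u : S.Control) :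
    ∀ᵐ t ∂volume.restrict (Icc S.t₀ S.T),
      ‖S.kernel i x₀ u t‖ ≤ Real.exp (Λ₁ * (S.T - S.t₀)) * S.inputNorm := by
  filter_upwards [hS.ae_norm_input_le, ae_restrict_mem measurableSet_Icc] with t hB ht
  refine (ContinuousLinearMap.opNorm_comp_le _ _).trans ?_
  gcongr
  · exact hS.norm_fderiv_flow_le ht (hS.tau_mem i) _
  · exact hB _

theorem ae_norm_kernel_sub_le (hS : S.Regular Λ₁ Λ₂ L_B) (i : Fin 2) (x₀ : Vec d)
    (u v : S.Control) :
    ∀ᵐ t ∂volume.restrict (Icc S.t₀ S.T), ‖S.kernel i x₀ u t - S.kernel i x₀ v t‖ ≤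
      (Real.exp (Λ₁ * (S.T - S.t₀)) * L_B +
        Λ₂ * (S.T - S.t₀) * Real.exp (Λ₁ * (S.T - S.t₀)) ^ 3 * S.inputNorm) *
        ‖S.trajectory x₀ u t - S.trajectory x₀ v t‖ := by
  filter_upwards [hS.ae_norm_input_le, ae_restrict_mem measurableSet_Icc] with t hB ht
  set x := S.trajectory x₀ u t
  set y := S.trajectory x₀ v t
  have hflow := hS.norm_fderiv_flow_sub_le ht ht (hS.tau_mem i) x y
  rw [(hS.isPrimitiveOn_fderiv_flow ht y).apply_base ht,
    (hS.isPrimitiveOn_flow ht y).apply_base ht, sub_self, norm_zero, zero_add] at hflow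
  unfold kernel
  set e := Real.exp (Λ₁ * (S.T - S.t₀))
  set A := fderiv ℝ (S.flow t (S.tau i)) x
  set A' := fderiv ℝ (S.flow t (S.tau i)) y
  have hA : ‖A‖ ≤ e := hS.norm_fderiv_flow_le ht (hS.tau_mem i) x
  have h1 : A ∘L S.B t x - A' ∘L S.B t y = A ∘L (S.B t x - S.B t y) + (A - A') ∘L S.B t y := by
    rw [ContinuousLinearMap.comp_sub, ContinuousLinearMap.sub_comp]
    abel
  rw [h1]
  calc _ ≤ ‖A ∘L (S.B t x - S.B t y)‖ + ‖(A - A') ∘L S.B t y‖ := norm_add_le _ _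
    _ ≤ ‖A‖ * ‖S.B t x - S.B t y‖ + ‖A - A'‖ * ‖S.B t y‖ :=
        add_le_add (ContinuousLinearMap.opNorm_comp_le _ _)
          (ContinuousLinearMap.opNorm_comp_le _ _)
    _ ≤ e * (L_B * ‖x - y‖) +
        (Λ₂ * (‖x - y‖ * e) * e * (S.T - S.t₀) * e) * S.inputNorm := by
        gcongr
        · exact hS.norm_input_sub_le ht x y
        · exact (norm_nonneg _).trans hflow
        · exact hB y
    _ = _ := by ring

/-! ### The Gramian: symmetry, positivity, Lipschitz dependence on the control -/

theorem intervalIntegrable_gramian (hS : S.Regular Λ₁ Λ₂ L_B) (i : Fin 2) (x₀ : Vec d)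
    (u : S.Control) :
    IntervalIntegrable
      (fun t => S.kernel i x₀ u t ∘L ContinuousLinearMap.adjoint (S.kernel i x₀ u t))
      volume S.t₀ S.T := by
  rw [intervalIntegrable_iff_integrableOn_Icc_of_le hS.time_lt.le]
  have hm := hS.aestronglyMeasurable_kernel i x₀ u
  have hβ := S.inputNorm_nonneg
  refine Integrable.of_bound (C := (Real.exp (Λ₁ * (S.T - S.t₀)) * S.inputNorm) *
    (Real.exp (Λ₁ * (S.T - S.t₀)) * S.inputNorm))
    (isBoundedBilinearMap_comp.continuous.comp_aestronglyMeasurable (hm.prodMk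
      (ContinuousLinearMap.adjoint.continuous.comp_aestronglyMeasurable hm))) ?_
  filter_upwards [hS.ae_norm_kernel_le i x₀ u] with t ht
  refine (ContinuousLinearMap.opNorm_comp_le _ _).trans ?_
  rw [LinearIsometryEquiv.norm_map]
  gcongr

theorem inner_gramian_apply (hS : S.Regular Λ₁ Λ₂ L_B) (i : Fin 2) (x₀ : Vec d)
    (u : S.Control) (x y : Vec d) :
    inner ℝ (S.gramian i x₀ u x) y =
      ∫ t in S.t₀..S.T, inner ℝ (ContinuousLinearMap.adjoint (S.kernel i x₀ u t) x)
        (ContinuousLinearMap.adjoint (S.kernel i x₀ u t) y) := by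
  have h := ((innerSL ℝ y).comp (ContinuousLinearMap.apply ℝ (Vec d) x)).intervalIntegral_comp_comm
    (hS.intervalIntegrable_gramian i x₀ u)
  rw [real_inner_comm]
  refine h.symm.trans (intervalIntegral.integral_congr fun t _ => ?_)
  change inner ℝ y (S.kernel i x₀ u t (ContinuousLinearMap.adjoint (S.kernel i x₀ u t) x)) = _
  rw [← ContinuousLinearMap.adjoint_inner_left, real_inner_comm]

theorem isSymmetric_gramian (hS : S.Regular Λ₁ Λ₂ L_B) (i : Fin 2) (x₀ : Vec d)
    (u : S.Control) : (S.gramian i x₀ u : Vec d →ₗ[ℝ] Vec d).IsSymmetric := fun x y => by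
  change inner ℝ (S.gramian i x₀ u x) y = inner ℝ x (S.gramian i x₀ u y)
  rw [hS.inner_gramian_apply, ← real_inner_comm, hS.inner_gramian_apply]
  simp only [real_inner_comm]

theorem inner_gramian_self_nonneg (hS : S.Regular Λ₁ Λ₂ L_B) (i : Fin 2) (x₀ : Vec d)
    (u : S.Control) (x : Vec d) : 0 ≤ inner ℝ (S.gramian i x₀ u x) x := by
  rw [hS.inner_gramian_apply]
  exact intervalIntegral.integral_nonneg hS.time_lt.le fun _ _ => real_inner_self_nonneg

/-- The Gramian map is Lipschitz on bounded sets of controls. -/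
theorem exists_lipschitzOnWith_gramian (hS : S.Regular Λ₁ Λ₂ L_B) (i : Fin 2) (x₀ : Vec d)
    (R : ℝ) : ∃ L : ℝ≥0, 0 < L ∧
      LipschitzOnWith L (S.gramian i x₀) {u : S.Control | ‖u‖ ≤ R} := by
  set e := Real.exp (Λ₁ * (S.T - S.t₀))
  have hL := hS.L_B_nonneg
  have hΛ := hS.Λ₁_pos
  have hΛ₂ := hS.Λ₂_pos
  have hβ := S.inputNorm_nonneg
  have hΔ : 0 ≤ S.T - S.t₀ := sub_nonneg.2 hS.time_lt.le
  -- `max R 0` covers negative `R`, where the ball is empty.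
  set K := (e * L_B + Λ₂ * (S.T - S.t₀) * e ^ 3 * S.inputNorm) *
    (S.inputNorm * (S.T - S.t₀) * Real.exp ((Λ₁ + L_B * max R 0) * (S.T - S.t₀)))
  have hK : 0 ≤ K := by positivity
  -- The added 1 keeps the constant strictly positive, for instance when `‖B‖_∞ = 0`.
  have hpos : 0 < 2 * (e * S.inputNorm) * K * (S.T - S.t₀) + 1 := by positivity
  refine ⟨⟨_, hpos.le⟩, hpos, LipschitzOnWith.of_dist_le_mul fun u hu v _ => ?_⟩
  rw [dist_eq_norm, dist_eq_norm]
  have hker : ∀ᵐ t ∂volume.restrict (Icc S.t₀ S.T),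
      ‖S.kernel i x₀ u t - S.kernel i x₀ v t‖ ≤ K * ‖u - v‖ := by
    filter_upwards [hS.ae_norm_kernel_sub_le i x₀ u v, ae_restrict_mem measurableSet_Icc]
      with t h1 ht
    refine (h1.trans (mul_le_mul_of_nonneg_left (hS.norm_trajectory_sub_le x₀ (le_max_right R 0)
      (hu.trans (le_max_left R 0)) ht) (by positivity))).trans_eq (mul_assoc _ _ _).symm
  have hbound : ∀ᵐ t ∂volume.restrict (Icc S.t₀ S.T),
      ‖S.kernel i x₀ u t ∘L ContinuousLinearMap.adjoint (S.kernel i x₀ u t) -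
        S.kernel i x₀ v t ∘L ContinuousLinearMap.adjoint (S.kernel i x₀ v t)‖ ≤
        2 * (e * S.inputNorm) * (K * ‖u - v‖) := by
    filter_upwards [hker, hS.ae_norm_kernel_le i x₀ u, hS.ae_norm_kernel_le i x₀ v]
      with t h1 h2 h3
    set A := S.kernel i x₀ u t
    set A' := S.kernel i x₀ v t
    have h4 : A ∘L ContinuousLinearMap.adjoint A - A' ∘L ContinuousLinearMap.adjoint A' =
        A ∘L ContinuousLinearMap.adjoint (A - A') + (A - A') ∘L ContinuousLinearMap.adjoint A' := by
      rw [map_sub, ContinuousLinearMap.comp_sub, ContinuousLinearMap.sub_comp]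
      abel
    rw [h4]
    calc _ ≤ ‖A ∘L ContinuousLinearMap.adjoint (A - A')‖ +
          ‖(A - A') ∘L ContinuousLinearMap.adjoint A'‖ := norm_add_le _ _
      _ ≤ ‖A‖ * ‖A - A'‖ + ‖A - A'‖ * ‖A'‖ := by
          refine add_le_add ((ContinuousLinearMap.opNorm_comp_le _ _).trans_eq ?_)
            ((ContinuousLinearMap.opNorm_comp_le _ _).trans_eq ?_)
          · rw [LinearIsometryEquiv.norm_map]
          · rw [LinearIsometryEquiv.norm_map]
      _ ≤ (e * S.inputNorm) * (K * ‖u - v‖) + (K * ‖u - v‖) * (e * S.inputNorm) := by gcongr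
      _ = _ := by ring
  unfold gramian
  rw [← intervalIntegral.integral_sub (hS.intervalIntegrable_gramian i x₀ u)
    (hS.intervalIntegrable_gramian i x₀ v)]
  have h5 := intervalIntegral.norm_integral_le_abs_of_norm_le (μ := volume)
    (ae_mono (Measure.restrict_mono (uIoc_subset_uIcc.trans (uIcc_of_le hS.time_lt.le).subset)
      le_rfl) hbound) intervalIntegrable_const
  rw [intervalIntegral.integral_const, smul_eq_mul, abs_of_nonneg (by positivity)] at h5
  refine h5.trans ?_
  change _ ≤ (2 * (e * S.inputNorm) * K * (S.T - S.t₀) + 1) * ‖u - v‖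
  nlinarith [norm_nonneg (u - v)]

/-! ### Bounds for the synthesis map -/

theorem ae_norm_minimalControl_le (hS : S.Regular Λ₁ Λ₂ L_B) (i : Fin 2) (x₀ y : Vec d)
    (u : S.Control) :
    ∀ᵐ t ∂volume.restrict (Icc S.t₀ S.T), ‖S.minimalControl i x₀ y u t‖ ≤
      Real.exp (Λ₁ * (S.T - S.t₀)) * S.inputNorm * ‖pseudoinverse (S.gramian i x₀ u) y‖ := by
  filter_upwards [hS.ae_norm_kernel_le i x₀ u] with t ht
  refine ContinuousLinearMap.le_of_opNorm_le _ ?_ _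
  rwa [LinearIsometryEquiv.norm_map]

theorem memLp_minimalControl (hS : S.Regular Λ₁ Λ₂ L_B) (i : Fin 2) (x₀ y : Vec d)
    (u : S.Control) : MemLp (S.minimalControl i x₀ y u) ∞ S.timeMeasure := by
  rw [S.timeMeasure_eq]
  exact memLp_top_of_bound
    (((ContinuousLinearMap.apply ℝ (Vec k)
      (pseudoinverse (S.gramian i x₀ u) y)).continuous.comp
      ContinuousLinearMap.adjoint.continuous).comp_aestronglyMeasurable
        (hS.aestronglyMeasurable_kernel i x₀ u)) _ (hS.ae_norm_minimalControl_le i x₀ y u)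

theorem coeFn_synthesis (hS : S.Regular Λ₁ Λ₂ L_B) (i : Fin 2) (x₀ y : Vec d)
    (u : S.Control) :
    ⇑(S.synthesis i x₀ y u) =ᵐ[S.timeMeasure] S.minimalControl i x₀ y u := by
  rw [synthesis, dif_pos (hS.memLp_minimalControl i x₀ y u)]
  exact MemLp.coeFn_toLp _

theorem norm_synthesis_le (hS : S.Regular Λ₁ Λ₂ L_B) (hd : 0 < d) {i : Fin 2} {x₀ : Vec d}
    {C : ℝ} (hC : 0 < C) (y : Vec d) {u : S.Control} (hu : u ∈ S.coercivityClass i x₀ C) :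
    ‖S.synthesis i x₀ y u‖ ≤ S.zeta Λ₁ C y := by
  rw [Lp.norm_def, eLpNorm_exponent_top]
  refine ENNReal.toReal_le_of_le_ofReal (S.zeta_nonneg hC.le y)
    (eLpNormEssSup_le_of_ae_bound ?_)
  have h := hS.ae_norm_minimalControl_le i x₀ y u
  rw [← S.timeMeasure_eq] at h
  filter_upwards [h, hS.coeFn_synthesis i x₀ y u] with t h1 h2
  rw [h2]
  refine h1.trans ?_
  have h3 := norm_pseudoinverse_apply_le hd (hS.isSymmetric_gramian i x₀ u) (inv_pos.2 hC) hu y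
  rw [inv_inv] at h3
  have hβ := S.inputNorm_nonneg
  calc _ ≤ Real.exp (Λ₁ * (S.T - S.t₀)) * S.inputNorm * (C * ‖y‖) := by gcongr
    _ = _ := by unfold zeta; ring

end Regular

end ControlSystem

theorem theorem3p10 {d k : ℕ} (hd : 0 < d) (S : ControlSystem d k) (Λ₁ Λ₂ L_B : ℝ)
    (hS : S.Regular Λ₁ Λ₂ L_B) (i : Fin 2) (x₀ : Vec d) (uref : S.Control)
    (hinv : IsUnit (S.gramian i x₀ uref)) (θ : ℝ) (hθ₀ : 0 < θ) (hθ₁ : θ < 1)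
    (C : ℝ) (hC : C = (1 + θ) / lambdaMin (S.gramian i x₀ uref)) :
    -- the Gramian map is Lipschitz on bounded sets, and the synthesis map is well defined
    (∀ R : ℝ, ∃ L : ℝ≥0, 0 < L ∧
      LipschitzOnWith L (S.gramian i x₀) {u : S.Control | ‖u‖ ≤ R}) ∧
    (∀ (y : Vec d) (u : S.Control),
      ⇑(S.synthesis i x₀ y u) =ᵐ[S.timeMeasure] S.minimalControl i x₀ y u) ∧
    ∀ (y : Vec d) (L : ℝ≥0), 0 < L →
      LipschitzOnWith L (S.gramian i x₀) ({u : S.Control | ‖u‖ ≤ S.zeta Λ₁ C y} ∪ {uref}) →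
      ‖uref‖ < θ * lambdaMin (S.gramian i x₀ uref) / ((1 + θ) * (L : ℝ)) →
      (S.coercivityClass i x₀ C).Nonempty ∧
      (‖y‖ ≤ S.admissibleRadius i x₀ Λ₁ θ L uref →
        MapsTo (S.synthesis i x₀ y) (S.feasibleBall i x₀ Λ₁ C y)
          (S.feasibleBall i x₀ Λ₁ C y)) := by
  set l := lambdaMin (S.gramian i x₀ uref)
  have hlpos : 0 < l := lambdaMin_pos hd (hS.isSymmetric_gramian i x₀ uref)
    (hS.inner_gramian_self_nonneg i x₀ uref) hinv
  have hθ : 0 < 1 + θ := by linarith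
  have hCpos : 0 < C := hC ▸ div_pos hθ hlpos
  -- The coercivity threshold, written as `l` minus the loss that the perturbation may cause.
  have hCinv : C⁻¹ = l - θ * l / (1 + θ) := by
    rw [hC, inv_div]
    field_simp
    ring
  refine ⟨hS.exists_lipschitzOnWith_gramian i x₀, hS.coeFn_synthesis i x₀,
    fun y L hL hlip huref => ⟨⟨uref, ?_⟩, fun hy u hu => ?_⟩⟩
  · change C⁻¹ ≤ l
    have : 0 ≤ θ * l / (1 + θ) := by positivity
    linarith
  have hnorm := hS.norm_synthesis_le hd hCpos y hu.1
  refine ⟨?_, hnorm⟩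
  have hL' : (0 : ℝ) < L := hL
  set e := Real.exp (Λ₁ * (S.T - S.t₀))
  have he : 0 < e := Real.exp_pos _
  have hzeta : S.zeta Λ₁ C y ≤ θ * l / ((1 + θ) * L) - ‖uref‖ := by
    -- If `‖B‖_∞ = 0` the radius involves a division by zero; then `ζ(y) = 0` and the smallness of
    -- `uref` suffices.
    rcases S.inputNorm_nonneg.eq_or_lt with h0 | h0
    · rw [ControlSystem.zeta, ← h0]
      simp only [mul_zero, zero_mul]
      linarith
    · calc S.zeta Λ₁ C y = (1 + θ) / l * S.inputNorm * e * ‖y‖ := by rw [ControlSystem.zeta, hC]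
        _ ≤ (1 + θ) / l * S.inputNorm * e * (l / ((1 + θ) * S.inputNorm * e) *
            (θ * l / ((1 + θ) * L) - ‖uref‖)) := by gcongr; exact hy
        _ = θ * l / ((1 + θ) * L) - ‖uref‖ := by field_simp
  set v := S.synthesis i x₀ y u
  have hdist := hlip.dist_le_mul v (Or.inl hnorm) uref (Or.inr rfl)
  rw [dist_eq_norm, dist_eq_norm] at hdist
  have h1 := lambdaMin_sub_norm_sub_le hd (hS.isSymmetric_gramian i x₀ uref)
    (hS.isSymmetric_gramian i x₀ v)
  -- By the triangle inequality `‖v - uref‖ ≤ ζ(y) + ‖uref‖`, which `hzeta` bounds.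
  have h2 : (L : ℝ) * ‖v - uref‖ ≤ L * (θ * l / ((1 + θ) * L)) := by
    gcongr
    linarith [norm_sub_le v uref]
  have h3 : (L : ℝ) * (θ * l / ((1 + θ) * L)) = θ * l / (1 + θ) := by field_simp
  change C⁻¹ ≤ lambdaMin (S.gramian i x₀ v)
  linarith
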